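/- Let $\{0,1\}^{\mathbb N}$ be the Cantor space, with the metric $d(\sigma,\sigma)=0$ and $d(\sigma,\tau)=\frac1n$ for $\sigma\neq\tau$, where $n\ge 1$ is the least index with $\sigma(n)\neq\tau(n)$. Let $\mathcal H(\{0,1\}^{\mathbb N})$ be the (Baire) space of all homeomorphisms of $\{0,1\}^{\mathbb N}$ onto itself, with the metric $\tilde d(f,g)=\max_{x} d(f(x),g(x))$. Let $\mathcal M(\{0,1\}^{\mathbb N})$ be the space of all Borel probability measures on $\{0,1\}^{\mathbb N}$ with the Prohorov metric $$d_P(\mu,\nu)=\inf\{\delta>0:\ \mu(X)\le\nu(X^\delta)+\delta\ \text{and}\ \nu(X)\le\mu(X^\delta)+\delta\ \text{for all Borel sets } X\},$$ where $Y^\delta$ denotes the set of points at distance less than $\delta$ from $Y$. For $h\in\mathcal H(\{0,1\}^{\mathbb N})$ let $\tilde h:\mathcal M(\{0,1\}^{\mathbb N})\to\mathcal M(\{0,1\}^{\mathbb N})$ be the induced homeomorphism, $(\tilde h(\mu))(X)=\mu(h^{-1}(X))$ for every Borel set $X$. A homeomorphism $g$ of a compact metric space $(M,\rho)$ has the weak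 shadowing property if for every $\varepsilon>0$ there is $\delta>0$ such that for every sequence $(x_n)_{n\in\mathbb Z}$ in $M$ with $\rho(g(x_n),x_{n+1})\le\delta$ for all $n\in\mathbb Z$ there is $x\in M$ with $$\{x_n:n\in\mathbb Z\}\subset\{g^n(x):n\in\mathbb Z\}^{\varepsilon}.$$ Theorem. For the generic $h\in\mathcal H(\{0,1\}^{\mathbb N})$, the induced homeomorphism $\tilde h$ does not have the weak shadowing property; that is, the set of all $h\in\mathcal H(\{0,1\}^{\mathbb N})$ for which $\tilde h$ has the weak shadowing property is of the first category in $\mathcal H(\{0,1\}^{\mathbb N})$. -/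

import Mathlib

open MeasureTheory Metric Topology

/-- The Cantor space `{0,1}^ℕ`; Mathlib's product topology and product σ-algebra
(which is its Borel σ-algebra) are used. -/
abbrev Cantor : Type := ℕ → Bool

namespace Cantor

open Classical in
/-- The distance on the Cantor space: `d(σ, τ) = 1 / n`, where `n` is the position, counted from
`1`, of the first coordinate at which `σ` and `τ` differ. (`PiNat.firstDiff` counts from `0`.) -/
noncomputable def cdist (σ τ : Cantor) : ℝ :=
  if σ = τ then 0 else 1 / ((PiNat.firstDiff σ τ : ℝ) + 1)

theorem cdist_self (σ : Cantor) : cdist σ σ = 0 := by simp [cdist]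

theorem cdist_comm (σ τ : Cantor) : cdist σ τ = cdist τ σ := by
  unfold cdist
  rw [PiNat.firstDiff_comm σ τ]
  by_cases h : σ = τ
  · rw [if_pos h, if_pos h.symm]
  · rw [if_neg h, if_neg (Ne.symm h)]

theorem cdist_nonneg (σ τ : Cantor) : 0 ≤ cdist σ τ := by
  unfold cdist; split_ifs <;> positivity

theorem eq_of_cdist_eq_zero (σ τ : Cantor) (h : cdist σ τ = 0) : σ = τ := by
  by_contra hne
  have : (0 : ℝ) < 1 / ((PiNat.firstDiff σ τ : ℝ) + 1) := by positivity
  simp only [cdist, hne, if_false] at h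
  linarith

theorem cdist_lt_iff (σ τ : Cantor) (n : ℕ) :
    cdist σ τ < 1 / ((n : ℝ) + 1) ↔ ∀ i ≤ n, σ i = τ i := by
  by_cases hne : σ = τ
  · subst hne
    simp only [cdist_self, implies_true, iff_true]
    positivity
  · simp only [cdist, hne, if_false]
    rw [one_div_lt_one_div (by positivity) (by positivity)]
    have h1 : (n : ℝ) + 1 < (PiNat.firstDiff σ τ : ℝ) + 1 ↔ n < PiNat.firstDiff σ τ := by
      constructor
      · intro h; exact_mod_cast (by linarith : (n : ℝ) < PiNat.firstDiff σ τ)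
      · intro h
        have : (n : ℝ) < PiNat.firstDiff σ τ := by exact_mod_cast h
        linarith
    rw [h1]
    constructor
    · intro h i hi
      exact PiNat.apply_eq_of_lt_firstDiff (lt_of_le_of_lt hi h)
    · intro h
      by_contra hlt
      exact PiNat.apply_firstDiff_ne hne (h _ (not_lt.1 hlt))

theorem cdist_triangle (σ τ ρ : Cantor) : cdist σ ρ ≤ cdist σ τ + cdist τ ρ := by
  by_cases h1 : σ = τ
  · subst h1; simp [cdist_self]
  by_cases h2 : τ = ρ
  · subst h2; simp [cdist_self]
  by_cases h3 : σ = ρ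
  · subst h3; rw [cdist_self]; exact add_nonneg (cdist_nonneg _ _) (cdist_nonneg _ _)
  have key := PiNat.min_firstDiff_le σ τ ρ h3
  have hA := cdist_nonneg σ τ
  have hB := cdist_nonneg τ ρ
  rcases min_le_iff.1 key with h | h
  · have : cdist σ ρ ≤ cdist σ τ := by
      simp only [cdist, h1, h3, if_false]
      gcongr
    linarith
  · have : cdist σ ρ ≤ cdist τ ρ := by
      simp only [cdist, h2, h3, if_false]
      gcongr
    linarith

theorem isOpen_iff_cdist (s : Set Cantor) :
    IsOpen s ↔ ∀ x ∈ s, ∃ ε > 0, ∀ y, cdist x y < ε → y ∈ s := by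
  rw [(PiNat.isTopologicalBasis_cylinders (fun _ : ℕ => Bool)).isOpen_iff]
  constructor
  · intro h x hx
    obtain ⟨v, ⟨y, n, rfl⟩, hxv, hvs⟩ := h x hx
    refine ⟨1 / ((n : ℝ) + 1), by positivity, fun z hz => hvs ?_⟩
    intro i hi
    rw [← hxv i hi]
    exact ((cdist_lt_iff x z n).1 hz i hi.le).symm
  · intro h x hx
    obtain ⟨ε, hε, hs⟩ := h x hx
    obtain ⟨n, hn⟩ := exists_nat_one_div_lt hε
    refine ⟨PiNat.cylinder x (n + 1), ⟨x, n + 1, rfl⟩, PiNat.self_mem_cylinder _ _, ?_⟩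
    intro z hz
    refine hs z (lt_trans ((cdist_lt_iff x z n).2 fun i hi => ?_) hn)
    exact (hz i (Nat.lt_succ_of_le hi)).symm

/-- The metric `cdist`, on top of the product topology and product uniformity. -/
noncomputable instance : MetricSpace Cantor :=
  (MetricSpace.ofDistTopology cdist cdist_self cdist_comm cdist_triangle isOpen_iff_cdist
    eq_of_cdist_eq_zero).replaceUniformity (by
      exact congrArg (fun u : UniformSpace Cantor => @uniformity Cantor u)
        (unique_uniformity_of_compact rfl rfl))

theorem dist_def (σ τ : Cantor) : dist σ τ = cdist σ τ := rfl

end Cantor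

section Homeomorphisms

variable {M : Type*} [MetricSpace M] [CompactSpace M]

/-- The space of homeomorphisms of a compact metric space with the uniform metric
`d(f, g) = max_x d(f x, g x)`. -/
noncomputable instance Homeomorph.instMetricSpaceOfCompact : MetricSpace (M ≃ₜ M) :=
  MetricSpace.induced (fun h : M ≃ₜ M => (h : C(M, M)))
    (fun _ _ h => Homeomorph.ext fun x => DFunLike.congr_fun h x) inferInstance

theorem Homeomorph.dist_eq_iSup (f g : M ≃ₜ M) : dist f g = ⨆ x, dist (f x) (g x) :=
  ContinuousMap.dist_eq_iSup (f := (f : C(M, M))) (g := (g : C(M, M)))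

theorem Homeomorph.dist_le_iff (f g : M ≃ₜ M) {r : ℝ} (hr : 0 ≤ r) :
    dist f g ≤ r ↔ ∀ x, dist (f x) (g x) ≤ r :=
  ContinuousMap.dist_le (f := (f : C(M, M))) (g := (g : C(M, M))) hr

theorem Homeomorph.continuous_coe_continuousMap :
    Continuous (fun h : M ≃ₜ M => (h : C(M, M))) :=
  continuous_induced_dom

theorem Homeomorph.continuous_symm_continuousMap :
    Continuous (fun h : M ≃ₜ M => (h.symm : C(M, M))) := by
  rw [Metric.continuous_iff]
  intro h ε hε
  obtain ⟨δ, hδ, H⟩ := Metric.uniformContinuous_iff.1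
    (CompactSpace.uniformContinuous_of_continuous h.symm.continuous) (ε / 2) (half_pos hε)
  refine ⟨δ, hδ, fun g hg => ?_⟩
  refine lt_of_le_of_lt ((ContinuousMap.dist_le (half_pos hε).le).2 fun y => ?_) (half_lt_self hε)
  have h1 : dist (g (g.symm y)) (h (g.symm y)) < δ :=
    lt_of_le_of_lt ((Homeomorph.dist_le_iff g h dist_nonneg).1 le_rfl _) hg
  have h2 := H h1
  rw [Homeomorph.symm_apply_apply, Homeomorph.apply_symm_apply, dist_comm] at h2
  exact h2.le

/-- The space of homeomorphisms of a compact metric space is a Baire space. -/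
instance Homeomorph.instBaireSpaceOfCompact : BaireSpace (M ≃ₜ M) := by
  let e : (M ≃ₜ M) → C(M, M) × C(M, M) := fun h => ((h : C(M, M)), (h.symm : C(M, M)))
  have hc : Continuous e :=
    Homeomorph.continuous_coe_continuousMap.prodMk Homeomorph.continuous_symm_continuousMap
  have hi : IsInducing e := by
    refine IsInducing.of_comp hc continuous_fst ⟨rfl⟩
  have hr : Set.range e = {p | p.1.comp p.2 = ContinuousMap.id M} ∩
      {p | p.2.comp p.1 = ContinuousMap.id M} := by
    ext p
    constructor
    · rintro ⟨h, rfl⟩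
      exact ⟨by ext x; simp [e], by ext x; simp [e]⟩
    · rintro ⟨h1, h2⟩
      exact ⟨⟨⟨p.1, p.2, fun x => DFunLike.congr_fun h2 x, fun x => DFunLike.congr_fun h1 x⟩,
        p.1.continuous, p.2.continuous⟩, rfl⟩
  have hcl : IsClosed (Set.range e) := by
    rw [hr]
    exact (isClosed_eq (continuous_fst.compCM continuous_snd) continuous_const).inter
      (isClosed_eq (continuous_snd.compCM continuous_fst) continuous_const)
  have hce : IsClosedEmbedding e := ⟨⟨hi, hi.injective⟩, hcl⟩
  have := hce.IsCompletelyMetrizableSpace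
  infer_instance

end Homeomorphisms

/-- The generic element of the Baire space `Z` has the property `P`: the set of all elements of `Z`
that do not satisfy `P` is of the first category. -/
def GenericElement (Z : Type*) [TopologicalSpace Z] [BaireSpace Z] (P : Z → Prop) : Prop :=
  IsMeagre {z : Z | ¬ P z}

section Induced

variable {M : Type*} [MetricSpace M] [MeasurableSpace M] [BorelSpace M]

variable (M) in
/-- The space of Borel probability measures on `M`, endowed with the Prohorov metric. -/
abbrev ProbSpace : Type _ := LevyProkhorov (ProbabilityMeasure M)

/-- The push-forward map `μ ↦ μ ∘ f⁻¹` on probability measures induced by a continuous map `f`. -/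
noncomputable def pushforward (f : C(M, M)) (μ : ProbSpace M) : ProbSpace M :=
  .ofMeasure (μ.toMeasure.map f.measurable.aemeasurable)

theorem pushforward_apply (f : C(M, M)) (μ : ProbSpace M) {X : Set M} (hX : MeasurableSet X) :
    ((pushforward f μ).toMeasure : Measure M) X = (μ.toMeasure : Measure M) (f ⁻¹' X) :=
  Measure.map_apply f.measurable hX

theorem pushforward_pushforward_of_leftInverse (f g : C(M, M)) (hfg : ∀ x, g (f x) = x)
    (μ : ProbSpace M) : pushforward g (pushforward f μ) = μ := by
  apply LevyProkhorov.toMeasure_injective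
  apply ProbabilityMeasure.toMeasure_injective
  ext X hX
  rw [pushforward_apply g _ hX, pushforward_apply f _ (g.measurable hX), ← Set.preimage_comp]
  congr 1
  ext x
  simp [hfg]

variable [CompactSpace M]

theorem continuous_pushforward (f : C(M, M)) : Continuous (pushforward f) :=
  LevyProkhorov.continuous_ofMeasure_probabilityMeasure.comp
    ((ProbabilityMeasure.continuous_map f.continuous).comp
      LevyProkhorov.continuous_toMeasure_probabilityMeasure)

/-- The homeomorphism of the space of Borel probability measures induced by a homeomorphism `h`
of `M`: it is `μ ↦ μ ∘ h⁻¹`. -/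
noncomputable def inducedHomeo (h : M ≃ₜ M) : ProbSpace M ≃ₜ ProbSpace M where
  toFun := pushforward h
  invFun := pushforward h.symm
  left_inv := pushforward_pushforward_of_leftInverse _ _ h.symm_apply_apply
  right_inv := pushforward_pushforward_of_leftInverse _ _ h.apply_symm_apply
  continuous_toFun := continuous_pushforward _
  continuous_invFun := continuous_pushforward _

end Induced

section Shadowing

variable {X : Type*} [MetricSpace X]

/-- The bi-infinite sequence `x` is a `δ`-pseudotrajectory of `h`. -/
def IsPseudotrajectory (h : X ≃ₜ X) (δ : ℝ) (x : ℤ → X) : Prop :=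
  ∀ n : ℤ, dist (h (x n)) (x (n + 1)) ≤ δ

/-- The weak shadowing property of a homeomorphism: for every `ε > 0` there is `δ > 0` such that
every `δ`-pseudotrajectory is contained in the `ε`-neighborhood of some full orbit. Here `h ^ n`
is the iterate in the group of homeomorphisms under composition. -/
def HasWeakShadowing (h : X ≃ₜ X) : Prop :=
  ∀ ε : ℝ, 0 < ε → ∃ δ : ℝ, 0 < δ ∧ ∀ x : ℤ → X, IsPseudotrajectory h δ x →
    ∃ y : X, Set.range x ⊆ thickening ε (Set.range fun n : ℤ => (h ^ n) y)

end Shadowing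

/-! ### Perturbing a homeomorphism to obtain an invariant clopen set -/

/-! A clopen set `C` with `h ⁻¹' C = C`, neither empty nor everything, obstructs weak shadowing: `μ
↦ μ C` is constant along orbits of the induced map and varies by at most `ε` under moves shorter
than a small `ε`. A pseudotrajectory can nevertheless transfer all the mass from `Cᶜ` to `C` in tiny
steps, so no single orbit passes near all of its terms (`not_hasWeakShadowing_inducedHomeo`).

Having such a `C` is generic. It is an open condition, because `C` and `Cᶜ` lie at positive
distance. For density (`Homeomorph.exists_dist_le_preimage_eq_isClopen`), take the least `k > 0`
such that `h ^ k` moves some point by less than `ε`, and close up the first `k` images of a small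
clopen set `U` into a cycle. If `h ^ k` is the identity near the point, `h` already does this;
otherwise compose `h` with the involution exchanging `U` and `h ^ k U`. Minimality of `k` keeps that
involution away from the intermediate images. -/

section InvariantClopen

/-- The involution that agrees with `φ` on `U` and with `φ⁻¹` on `φ '' U`, and fixes all other
points, where `U` is a clopen set disjoint from its image. -/
theorem Homeomorph.exists_swap {X : Type*} [TopologicalSpace X] (φ : X ≃ₜ X) {U : Set X}
    (hU : IsClopen U) (hd : ∀ x ∈ U, φ x ∉ U) :
    ∃ s : X ≃ₜ X, (∀ x ∈ U, s x = φ x) ∧ (∀ x ∈ U, s (φ x) = x) ∧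
      ∀ x, x ∉ U → φ.symm x ∉ U → s x = x := by
  classical
  let f : X → X := fun x => if x ∈ U then φ x else if x ∈ φ.symm ⁻¹' U then φ.symm x else x
  have hU' : IsClopen (φ.symm ⁻¹' U) := hU.preimage φ.symm.continuous
  have h1 : ∀ x ∈ U, f x = φ x := fun x hx => if_pos hx
  have h2 : ∀ x ∈ U, f (φ x) = x := fun x hx => by simp [f, hd x hx, hx]
  have h3 : ∀ x, x ∉ U → φ.symm x ∉ U → f x = x := fun x hx hx' => by simp [f, hx, hx']
  have hinv : Function.Involutive f := by
    intro x
    by_cases hx : x ∈ U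
    · rw [h1 x hx, h2 x hx]
    by_cases hx' : φ.symm x ∈ U
    · have h := h2 _ hx'
      rw [φ.apply_symm_apply] at h
      rw [h, h1 _ hx', φ.apply_symm_apply]
    · rw [h3 x hx hx', h3 x hx hx']
  -- Clopen sets have empty frontier, so the pieces glue without any matching condition.
  have hc : Continuous f := by
    refine Continuous.if (fun a ha => ?_) φ.continuous
      (Continuous.if (fun a ha => ?_) φ.symm.continuous continuous_id)
    · rw [show {x | x ∈ U} = U from rfl, hU.frontier_eq] at ha
      exact ha.elim
    · rw [show {x | x ∈ φ.symm ⁻¹' U} = φ.symm ⁻¹' U from rfl, hU'.frontier_eq] at ha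
      exact ha.elim
  exact ⟨⟨hinv.toPerm f, hc, hc⟩, h1, h2, h3⟩

/-- If `g` carries `U`, `h U`, …, `h ^ (k - 1) U` cyclically onto each other, then it leaves their
union invariant. -/
theorem Homeomorph.preimage_iUnion_image_pow_eq {X : Type*} [TopologicalSpace X] (g h : X ≃ₜ X)
    {U : Set X} {k : ℕ} (hk : 0 < k)
    (hstep : ∀ x ∈ U, ∀ i, i + 1 < k → g ((h ^ i) x) = (h ^ (i + 1)) x)
    (hlast : ∀ x ∈ U, g ((h ^ (k - 1)) x) = x) :
    g ⁻¹' (⋃ i : Fin k, (h ^ (i : ℕ)) '' U) = ⋃ i : Fin k, (h ^ (i : ℕ)) '' U := by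
  -- The union is contained in its image under `g`; injectivity of `g` turns this into the inclusion
  -- of the preimage in the union.
  have hsub : ∀ y ∈ ⋃ i : Fin k, (h ^ (i : ℕ)) '' U, ∃ w ∈ ⋃ i : Fin k, (h ^ (i : ℕ)) '' U,
      g w = y := by
    intro y hy
    obtain ⟨⟨i, hi⟩, x, hx, rfl⟩ := Set.mem_iUnion.1 hy
    rcases i with _ | i
    · exact ⟨_, Set.mem_iUnion.2 ⟨⟨k - 1, by omega⟩, x, hx, rfl⟩, hlast x hx⟩
    · exact ⟨_, Set.mem_iUnion.2 ⟨⟨i, by omega⟩, x, hx, rfl⟩, hstep x hx i hi⟩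
  ext y
  constructor
  · intro hy
    obtain ⟨w, hw, hwy⟩ := hsub _ hy
    exact g.injective hwy ▸ hw
  · intro hy
    obtain ⟨⟨i, hi⟩, x, hx, rfl⟩ := Set.mem_iUnion.1 hy
    rw [Set.mem_preimage]
    by_cases hik : i + 1 < k
    · exact Set.mem_iUnion.2 ⟨⟨i + 1, hik⟩, x, hx, (hstep x hx i hik).symm⟩
    · obtain rfl : i = k - 1 := by omega
      exact Set.mem_iUnion.2 ⟨⟨0, hk⟩, x, hx, (hlast x hx).symm⟩

/-- A point that is not fixed by finitely many given homeomorphisms has an open neighborhood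
that is disjoint from its images under these homeomorphisms. -/
theorem Homeomorph.exists_isOpen_forall_notMem {X : Type*} [TopologicalSpace X] [T2Space X]
    {x : X} {ι : Type*} (s : Finset ι) (f : ι → X ≃ₜ X) (hf : ∀ i ∈ s, f i x ≠ x) :
    ∃ U : Set X, IsOpen U ∧ x ∈ U ∧ ∀ i ∈ s, ∀ y ∈ U, f i y ∉ U := by
  have h : ∀ i : s, ∃ U : Set X, IsOpen U ∧ x ∈ U ∧ ∀ y ∈ U, f i y ∉ U := by
    intro i
    obtain ⟨u, v, hu, hv, hxu, hxv, huv⟩ := t2_separation (hf i i.2).symm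
    exact ⟨u ∩ f i ⁻¹' v, hu.inter (hv.preimage (f i).continuous), ⟨hxu, hxv⟩,
      fun y hy hy' => Set.disjoint_left.1 huv hy'.1 hy.2⟩
  choose U hU hxU hyU using h
  refine ⟨⋂ i, U i, isOpen_iInter_of_finite hU, Set.mem_iInter.2 hxU, fun i hi y hy hy' => ?_⟩
  exact hyU ⟨i, hi⟩ y (Set.mem_iInter.1 hy ⟨i, hi⟩) (Set.mem_iInter.1 hy' ⟨i, hi⟩)

variable {M : Type*} [MetricSpace M] [CompactSpace M]

/-- Every orbit in a compact space returns close to itself. -/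
theorem Homeomorph.exists_dist_pow_lt [Nonempty M] (h : M ≃ₜ M) {ε : ℝ} (hε : 0 < ε) :
    ∃ k : ℕ, 0 < k ∧ ∃ x, dist ((h ^ k) x) x < ε := by
  obtain ⟨x⟩ := ‹Nonempty M›
  obtain ⟨a, φ, hφ, ha⟩ := CompactSpace.tendsto_subseq fun n : ℕ => (h ^ n) x
  obtain ⟨N, hN⟩ := Metric.cauchySeq_iff'.1 ha.cauchySeq ε hε
  have hlt : φ N < φ (N + 1) := hφ N.lt_succ_self
  refine ⟨φ (N + 1) - φ N, by omega, (h ^ φ N) x, ?_⟩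
  rw [← Homeomorph.mul_apply, ← pow_add, Nat.sub_add_cancel hlt.le]
  exact hN (N + 1) N.le_succ

/-- Arbitrarily close to any homeomorphism of an infinite compact totally disconnected metric space
there is a homeomorphism with a nontrivial invariant clopen set. -/
theorem Homeomorph.exists_dist_le_preimage_eq_isClopen [TotallyDisconnectedSpace M] [Infinite M]
    (h : M ≃ₜ M) {ε : ℝ} (hε : 0 < ε) :
    ∃ g : M ≃ₜ M, dist g h ≤ ε ∧
      ∃ C : Set M, IsClopen C ∧ C.Nonempty ∧ Cᶜ.Nonempty ∧ g ⁻¹' C = C := by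
  classical
  have hex := h.exists_dist_pow_lt hε
  set k := Nat.find hex
  obtain ⟨hk, hV⟩ : 0 < k ∧ ∃ x, dist ((h ^ k) x) x < ε := Nat.find_spec hex
  -- A fixed point of `h ^ j` is moved by `0 < ε`, against the minimality of `k`.
  have hmin : ∀ j, 0 < j → j < k → ∀ x, (h ^ j) x ≠ x := by
    intro j hj hjk x hx
    exact Nat.find_min hex hjk ⟨hj, x, by rwa [hx, dist_self]⟩
  set V : Set M := {y | dist ((h ^ k) y) y < ε}
  have hVo : IsOpen V := isOpen_lt ((h ^ k).continuous.dist continuous_id) continuous_const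
  -- It suffices to find a small clopen set permuted cyclically by a perturbation of `h`.
  suffices H : ∃ x ∈ V, ∃ W : Set M, IsOpen W ∧ x ∈ W ∧ ∀ U ⊆ W, IsClopen U →
      ∃ g : M ≃ₜ M, dist g h ≤ ε ∧ (∀ x ∈ U, ∀ i, i + 1 < k → g ((h ^ i) x) = (h ^ (i + 1)) x) ∧
        ∀ x ∈ U, g ((h ^ (k - 1)) x) = x by
    obtain ⟨x, -, W, hW, hxW, H⟩ := H
    -- Shrinking `U` so that its first `k` images all miss `z` keeps the complement of their union
    -- nonempty.
    obtain ⟨z, hz⟩ := (Set.finite_range fun i : Fin k => (h ^ (i : ℕ)) x).exists_notMem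
    have hO : IsOpen (⋂ i : Fin k, (h ^ (i : ℕ)) ⁻¹' {z}ᶜ) :=
      isOpen_iInter_of_finite fun i => isOpen_compl_singleton.preimage (h ^ (i : ℕ)).continuous
    obtain ⟨U, hU, hxU, hUW⟩ := compact_exists_isClopen_in_isOpen (hW.inter hO)
      ⟨hxW, Set.mem_iInter.2 fun i hi => hz ⟨i, hi⟩⟩
    obtain ⟨g, hgh, hstep, hlast⟩ := H U (fun y hy => (hUW hy).1) hU
    refine ⟨g, hgh, ⋃ i : Fin k, (h ^ (i : ℕ)) '' U, ?_, ?_, ?_,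
      g.preimage_iUnion_image_pow_eq h hk hstep hlast⟩
    · refine isClopen_iUnion_of_finite fun i => ?_
      exact ⟨(h ^ (i : ℕ)).isClosed_image.2 hU.1, (h ^ (i : ℕ)).isOpen_image.2 hU.2⟩
    · exact ⟨_, Set.mem_iUnion.2 ⟨⟨0, hk⟩, x, hxU, rfl⟩⟩
    · refine ⟨z, fun hzC => ?_⟩
      obtain ⟨i, y, hy, hyz⟩ := Set.mem_iUnion.1 hzC
      exact Set.mem_iInter.1 (hUW hy).2 i hyz
  have hpow : ∀ i x, h ((h ^ i) x) = (h ^ (i + 1)) x := fun i x => by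
    rw [← Homeomorph.mul_apply, ← pow_succ']
  by_cases hfix : ∀ y ∈ V, (h ^ k) y = y
  · obtain ⟨x, hx⟩ := hV
    refine ⟨x, hx, V, hVo, hx, fun U hUV _ => ⟨h, ?_, fun x _ i _ => hpow i x, fun x hxU => ?_⟩⟩
    · rw [dist_self]; exact hε.le
    · rw [hpow, Nat.sub_add_cancel hk, hfix x (hUV hxU)]
  · push Not at hfix
    obtain ⟨x, hxV, hx⟩ := hfix
    obtain ⟨W, hW, hxW, hWd⟩ := Homeomorph.exists_isOpen_forall_notMem (Finset.Icc 1 k)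
      (fun j => h ^ j) (x := x) (fun j hj => by
        rw [Finset.mem_Icc] at hj
        rcases hj.2.lt_or_eq with hlt | rfl
        · exact hmin j hj.1 hlt x
        · exact hx)
    refine ⟨x, hxV, W ∩ V, hW.inter hVo, ⟨hxW, hxV⟩, fun U hUW hU => ?_⟩
    have hUd : ∀ j, 1 ≤ j → j ≤ k → ∀ y ∈ U, (h ^ j) y ∉ U := fun j hj hjk y hy hy' =>
      hWd j (Finset.mem_Icc.2 ⟨hj, hjk⟩) y (hUW hy).1 (hUW hy').1
    obtain ⟨s, hs1, hs2, hs3⟩ := (h ^ k).exists_swap hU (hUd k hk le_rfl)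
    refine ⟨s * h, (Homeomorph.dist_le_iff _ _ hε.le).2 fun y => ?_, fun y hy i hi => ?_,
      fun y hy => ?_⟩
    -- The involution moves a point only between `w` and `(h ^ k) w` with `w ∈ U ⊆ V`, hence by less
    -- than `ε`.
    · rw [Homeomorph.mul_apply]
      by_cases h1 : h y ∈ U
      · rw [hs1 _ h1]
        exact (hUW h1).2.le
      by_cases h2 : (h ^ k).symm (h y) ∈ U
      · have h3 := hs2 _ h2
        have h4 := (hUW h2).2
        simp only [V, Set.mem_ofPred_eq] at h4
        rw [Homeomorph.apply_symm_apply] at h3 h4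
        rw [h3, dist_comm]
        exact h4.le
      · rw [hs3 _ h1 h2, dist_self]
        exact hε.le
    · rw [Homeomorph.mul_apply, hpow]
      -- If `(h ^ (i + 1)) y` were in `h ^ k U`, then `h ^ (k - (i + 1))` would send a point of `U`
      -- to `y ∈ U`.
      refine hs3 _ (hUd (i + 1) (by omega) hi.le y hy) fun hmem => ?_
      refine hUd (k - (i + 1)) (by omega) (by omega) _ hmem ?_
      have h5 : h ^ (k - (i + 1)) = (h ^ (i + 1))⁻¹ * h ^ k := by
        rw [eq_inv_mul_iff_mul_eq, ← pow_add]
        congr 1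
        omega
      rw [h5, Homeomorph.mul_apply, Homeomorph.apply_symm_apply, Homeomorph.inv_apply,
        Homeomorph.symm_apply_apply]
      exact hy
    · rw [Homeomorph.mul_apply, hpow, Nat.sub_add_cancel hk, hs2 y hy]

/-- Leaving a given clopen set invariant is an open condition on homeomorphisms. -/
theorem Homeomorph.isOpen_setOf_preimage_eq {C : Set M} (hC : IsClopen C) :
    IsOpen {h : M ≃ₜ M | h ⁻¹' C = C} := by
  -- Both `C` and `Cᶜ` are compact and open, so a small uniform perturbation moves no value of `h`
  -- across the boundary.
  obtain ⟨δ₁, hδ₁, h₁⟩ := hC.1.isCompact.exists_thickening_subset_open hC.2 subset_rfl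
  obtain ⟨δ₂, hδ₂, h₂⟩ :=
    hC.compl.1.isCompact.exists_thickening_subset_open hC.compl.2 subset_rfl
  refine Metric.isOpen_iff.2 fun h hh => ⟨min δ₁ δ₂, lt_min hδ₁ hδ₂, fun g hg => ?_⟩
  have hh' : h ⁻¹' C = C := hh
  have hlt : ∀ x, dist (g x) (h x) < min δ₁ δ₂ := fun x =>
    ((Homeomorph.dist_le_iff g h dist_nonneg).1 le_rfl x).trans_lt hg
  ext x
  by_cases hx : x ∈ C
  · refine iff_of_true (h₁ (mem_thickening_iff.2 ⟨h x, ?_, (hlt x).trans_le (min_le_left _ _)⟩)) hx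
    exact hh'.ge hx
  · refine iff_of_false (h₂ (mem_thickening_iff.2 ⟨h x, fun hm => hx (hh'.le hm), ?_⟩)) hx
    exact (hlt x).trans_le (min_le_right _ _)

theorem Homeomorph.isOpen_setOf_exists_isClopen_preimage_eq :
    IsOpen {h : M ≃ₜ M | ∃ C : Set M, IsClopen C ∧ C.Nonempty ∧ Cᶜ.Nonempty ∧ h ⁻¹' C = C} := by
  simp only [Set.ofPred_exists, Set.ofPred_and]
  refine isOpen_iUnion fun C => ?_
  by_cases hC : IsClopen C
  · exact isOpen_const.inter (isOpen_const.inter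
      (isOpen_const.inter (Homeomorph.isOpen_setOf_preimage_eq hC)))
  · simp [hC]

theorem Homeomorph.dense_setOf_exists_isClopen_preimage_eq [TotallyDisconnectedSpace M]
    [Infinite M] :
    Dense {h : M ≃ₜ M | ∃ C : Set M, IsClopen C ∧ C.Nonempty ∧ Cᶜ.Nonempty ∧ h ⁻¹' C = C} := by
  refine Metric.dense_iff.2 fun h r hr => ?_
  obtain ⟨g, hg, hC⟩ := h.exists_dist_le_preimage_eq_isClopen (half_pos hr)
  exact ⟨g, Metric.mem_ball.2 (hg.trans_lt (half_lt_self hr)), hC⟩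

end InvariantClopen

/-! ### Invariant clopen sets obstruct weak shadowing on the space of measures -/

section Measures

variable {M : Type*} [MetricSpace M] [MeasurableSpace M] [BorelSpace M]

/-- The mass of `C` is constant along orbits of the induced homeomorphism when `C` is invariant. -/
theorem inducedHomeo_zpow_apply_of_preimage_eq [CompactSpace M] {h : M ≃ₜ M} {C : Set M}
    (hC : MeasurableSet C) (hh : h ⁻¹' C = C) (n : ℤ) (μ : ProbSpace M) :
    (((inducedHomeo h ^ n) μ).toMeasure : Measure M) C = (μ.toMeasure : Measure M) C := by
  have hstep : ∀ ν : ProbSpace M,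
      ((inducedHomeo h ν).toMeasure : Measure M) C = (ν.toMeasure : Measure M) C := by
    intro ν
    refine (pushforward_apply (h : C(M, M)) ν hC).trans ?_
    exact congrArg _ hh
  induction n with
  | zero => rfl
  | succ n ih => rw [add_comm, zpow_add, zpow_one, Homeomorph.mul_apply, hstep, ih]
  | pred n ih =>
    rw [← ih, ← hstep, ← Homeomorph.mul_apply, ← zpow_one_add]
    congr 3
    ring_nf

/-- The measure `t δ_p + (1 - t) δ_q`. -/
noncomputable def twoPointMeasure (t : Set.Icc (0 : ℝ) 1) (p q : M) : ProbSpace M :=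
  .ofMeasure ⟨ENNReal.ofReal t • Measure.dirac p + ENNReal.ofReal (1 - t) • Measure.dirac q, ⟨by
    have h := t.2
    simp only [Measure.add_apply, Measure.smul_apply, measure_univ, smul_eq_mul, mul_one]
    rw [← ENNReal.ofReal_add h.1 (by linarith [h.2])]
    simp⟩⟩

theorem toMeasure_twoPointMeasure {X : Type*} [MeasurableSpace X] (t : Set.Icc (0 : ℝ) 1)
    (p q : X) :
    ((twoPointMeasure t p q).toMeasure : Measure X) =
      ENNReal.ofReal t • Measure.dirac p + ENNReal.ofReal (1 - t) • Measure.dirac q := rfl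

theorem pushforward_twoPointMeasure (f : C(M, M)) (t : Set.Icc (0 : ℝ) 1) (p q : M) :
    pushforward f (twoPointMeasure t p q) = twoPointMeasure t (f p) (f q) := by
  apply LevyProkhorov.toMeasure_injective
  apply ProbabilityMeasure.toMeasure_injective
  ext X hX
  rw [pushforward_apply f _ hX]
  simp [toMeasure_twoPointMeasure, Measure.dirac_apply' _ hX,
    Measure.dirac_apply' _ (f.measurable hX), Set.indicator]
  rfl

/-- Changing the weight changes the mass of any set by at most `|s - t|`, so the thickening is not
needed. -/
theorem dist_twoPointMeasure_le (s t : Set.Icc (0 : ℝ) 1) (p q : M) :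
    dist (twoPointMeasure s p q) (twoPointMeasure t p q) ≤ |(s : ℝ) - t| := by
  rw [LevyProkhorov.dist_probabilityMeasure_def]
  refine levyProkhorovDist_le_of_forall_le _ _ (abs_nonneg _) fun ε B hε hB => ?_
  have hε0 : 0 < ε := (abs_nonneg _).trans_lt hε
  have hst := abs_lt.1 hε
  grw [← self_subset_thickening hε0 B]
  simp only [toMeasure_twoPointMeasure, Measure.add_apply, Measure.smul_apply, smul_eq_mul,
    Measure.dirac_apply' _ hB]
  have h1 : ENNReal.ofReal s ≤ ENNReal.ofReal t + ENNReal.ofReal ε := by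
    rw [← ENNReal.ofReal_add t.2.1 hε0.le]
    exact ENNReal.ofReal_le_ofReal (by linarith)
  have h2 : ENNReal.ofReal (1 - s) ≤ ENNReal.ofReal (1 - t) + ENNReal.ofReal ε := by
    rw [← ENNReal.ofReal_add (by linarith [t.2.2]) hε0.le]
    exact ENNReal.ofReal_le_ofReal (by linarith)
  have h3 : ∀ r : Set.Icc (0 : ℝ) 1, ENNReal.ofReal r + ENNReal.ofReal (1 - r) = 1 := fun r => by
    rw [← ENNReal.ofReal_add r.2.1 (by linarith [r.2.2])]
    simp
  by_cases hp : p ∈ B <;> by_cases hq : q ∈ B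
  · simp [hp, hq, h3]
  · simpa [hp, hq] using h1
  · simpa [hp, hq] using h2
  · simp [hp, hq]

/-- Thickening adds nothing to such a `C`, so the Prohorov inequality compares the masses of `C`
itself. -/
theorem measure_le_add_of_dist_lt {C : Set M} (hC : MeasurableSet C) {ε : ℝ}
    (hth : thickening ε C ⊆ C) {μ ν : ProbSpace M} (h : dist μ ν < ε) :
    (μ.toMeasure : Measure M) C ≤ (ν.toMeasure : Measure M) C + ENNReal.ofReal ε := by
  have hε : 0 < ε := dist_nonneg.trans_lt h
  rw [LevyProkhorov.dist_probabilityMeasure_def, levyProkhorovDist,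
    ← ENNReal.lt_ofReal_iff_toReal_lt (levyProkhorovEDist_ne_top _ _)] at h
  refine (left_measure_le_of_levyProkhorovEDist_lt h hC).trans ?_
  rw [ENNReal.toReal_ofReal hε.le]
  gcongr

/-- If `h` has a nontrivial invariant clopen set, then the induced homeomorphism of the space of
probability measures does not have the weak shadowing property: mass can be moved from the
invariant set to its complement along pseudotrajectories, but not along orbits. -/
theorem not_hasWeakShadowing_inducedHomeo [CompactSpace M] {h : M ≃ₜ M} {C : Set M}
    (hC : IsClopen C) (hne : C.Nonempty) (hne' : Cᶜ.Nonempty) (hh : h ⁻¹' C = C) :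
    ¬ HasWeakShadowing (inducedHomeo h) := by
  intro H
  obtain ⟨p, hp⟩ := hne
  obtain ⟨q, hq⟩ := hne'
  obtain ⟨r, hr, hrC⟩ := hC.1.isCompact.exists_thickening_subset_open hC.2 subset_rfl
  -- The bound `r` makes `C` equal to its thickening; `1 / 4` makes two errors of size `ε` total
  -- less than `1`.
  set ε : ℝ := min r (1 / 4)
  have hε : 0 < ε := lt_min hr (by norm_num)
  have hth : thickening ε C ⊆ C := (thickening_mono (min_le_left _ _) C).trans hrC
  obtain ⟨δ, hδ, H⟩ := H ε hε
  obtain ⟨N, hN⟩ := exists_nat_one_div_lt hδ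
  have hN0 : (0 : ℝ) < (N : ℝ) + 1 := by positivity
  have hinv : ∀ x, h x ∈ C ↔ x ∈ C := fun x => Set.ext_iff.1 hh x
  -- The weight on the orbit of `p` climbs from `0` at time `0` to `1` at time `N + 1` in steps of
  -- at most `1 / (N + 1) < δ`, and is constant outside.
  let t : ℤ → Set.Icc (0 : ℝ) 1 := fun n => Set.projIcc 0 1 zero_le_one ((n : ℝ) / ((N : ℝ) + 1))
  let x : ℤ → ProbSpace M := fun n => twoPointMeasure (t n) ((h ^ n) p) ((h ^ n) q)
  have hx : IsPseudotrajectory (inducedHomeo h) δ x := by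
    intro n
    have h1 : inducedHomeo h (x n) =
        twoPointMeasure (t n) ((h ^ (n + 1)) p) ((h ^ (n + 1)) q) := by
      refine (pushforward_twoPointMeasure (h : C(M, M)) _ _ _).trans ?_
      rw [add_comm n 1, zpow_one_add]
      rfl
    rw [h1]
    refine (dist_twoPointMeasure_le _ _ _ _).trans (le_trans ?_ hN.le)
    have h2 := Set.abs_projIcc_sub_projIcc (zero_le_one' ℝ) (c := (n : ℝ) / ((N : ℝ) + 1))
      (d := ((n + 1 : ℤ) : ℝ) / ((N : ℝ) + 1))
    refine h2.trans (le_of_eq ?_)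
    rw [← sub_div, Int.cast_add, Int.cast_one, sub_add_cancel_left, abs_div, abs_neg, abs_one,
      abs_of_pos hN0]
  obtain ⟨y, hy⟩ := H x hx
  have hzpow : ∀ (n : ℤ) (a : M), (h ^ n) a ∈ C ↔ a ∈ C := by
    intro n a
    induction n with
    | zero => rfl
    | succ n ih => rw [add_comm, zpow_one_add, Homeomorph.mul_apply, hinv, ih]
    | pred n ih =>
      rw [← ih, ← hinv, ← Homeomorph.mul_apply, ← zpow_one_add]
      ring_nf
  have hmass : ∀ n, ((x n).toMeasure : Measure M) C = ENNReal.ofReal (t n) := by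
    intro n
    simp only [x, toMeasure_twoPointMeasure, Measure.add_apply, Measure.smul_apply, smul_eq_mul,
      Measure.dirac_apply' _ hC.1.measurableSet,
      Set.indicator_of_mem ((hzpow n p).2 hp),
      Set.indicator_of_notMem (fun hm => hq ((hzpow n q).1 hm))]
    simp
  have hclose : ∀ n, ∃ m : ℤ, dist (x n) ((inducedHomeo h ^ m) y) < ε := by
    intro n
    obtain ⟨-, ⟨m, rfl⟩, hm⟩ := mem_thickening_iff.1 (hy ⟨n, rfl⟩)
    exact ⟨m, hm⟩
  have ht0 : (t 0 : ℝ) = 0 := by simp [t, Set.projIcc]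
  have ht1 : (t (N + 1) : ℝ) = 1 := by
    have h3 : (((N + 1 : ℤ) : ℝ)) / ((N : ℝ) + 1) = 1 := by
      push_cast
      exact div_self hN0.ne'
    simp only [t, h3]
    simp
  obtain ⟨m, hm⟩ := hclose 0
  obtain ⟨m', hm'⟩ := hclose (N + 1)
  rw [dist_comm] at hm
  have e1 := measure_le_add_of_dist_lt hC.1.measurableSet hth hm
  have e2 := measure_le_add_of_dist_lt hC.1.measurableSet hth hm'
  rw [inducedHomeo_zpow_apply_of_preimage_eq hC.1.measurableSet hh, hmass] at e1 e2
  rw [ht0, ENNReal.ofReal_zero, zero_add] at e1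
  rw [ht1] at e2
  -- The constant mass of `C` along the orbit of `y` is at most `ε` by time `0` and at least `1 - ε`
  -- by time `N + 1`, so `1 ≤ ε + ε`.
  have e3 := e2.trans (add_le_add_left e1 _)
  rw [← ENNReal.ofReal_add hε.le hε.le, ENNReal.ofReal_le_ofReal_iff (by linarith)] at e3
  have e4 : ε ≤ 1 / 4 := min_le_right _ _
  linarith

end Measures

theorem theorem4p8 :
    GenericElement (Cantor ≃ₜ Cantor) (fun h => ¬ HasWeakShadowing (inducedHomeo h)) := by
  refine Filter.mem_of_superset (residual_of_dense_open
    Homeomorph.isOpen_setOf_exists_isClopen_preimage_eq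
    Homeomorph.dense_setOf_exists_isClopen_preimage_eq) ?_
  rintro h ⟨C, hC, hne, hne', hh⟩ hmem
  exact hmem (not_hasWeakShadowing_inducedHomeo hC hne hne' hh)
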